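/- Let $\mathbb{D}=\{z\in\mathbb{C}:|z|<1\}$ and let $f:\mathbb{D}\to\mathbb{C}$ be a normalized convex mapping, that is, $f$ is holomorphic and injective on $\mathbb{D}$, $f(\mathbb{D})$ is a convex set, $f(0)=0$ and $f'(0)=1$. Let $a_2=f''(0)/2$ be the second Taylor coefficient of $f$ at the origin. If $f$ is bounded on $\mathbb{D}$, then there is a real constant $b>-\tfrac12$ (which may depend on $f$) such that $$\mathrm{Re}\{a_2 f(z)\}\ge b\qquad\text{for all } z\in\mathbb{D}.$$ -/

import Mathlib

/-- The class `𝒞` of normalized convex mappings: holomorphic injective functions `f` on the open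
unit disk with `f(0) = 0`, `f'(0) = 1`, whose image of the disk is a convex set. Values of `f`
outside the open unit disk play no role. -/
structure IsNormalizedConvexMapping (f : ℂ → ℂ) : Prop where
  differentiableOn : DifferentiableOn ℂ f (Metric.ball (0 : ℂ) 1)
  injOn : Set.InjOn f (Metric.ball (0 : ℂ) 1)
  convex_image : Convex ℝ (f '' Metric.ball (0 : ℂ) 1)
  map_zero : f 0 = 0
  deriv_zero : deriv f 0 = 1

/-- The `n`-th Taylor coefficient `f⁽ⁿ⁾(0) / n!` of `f` at the origin. -/
noncomputable def taylorCoeffAtZero (f : ℂ → ℂ) (n : ℕ) : ℂ :=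
  iteratedDeriv n f 0 / (n.factorial : ℂ)

open Metric Set Filter Topology ComplexConjugate

/-! By compactness `Re (a₂ v)` attains its minimum over the closure of the image at some `w`. If
this minimum is at most `-1/2`, then `a₂ ≠ 0`, so `w` is a boundary point, a limit of `f (xₙ)` with
`xₙ → ζ` and `|ζ| = 1`. The Suffridge inequality (`re_suffridge_nonneg`) passes to the limit: `F = 2
z f' / (f - w) - (z + ζ) / (z - ζ)` has nonnegative real part and `F 0 = 1`, so `(F - 1) / (F + 1) =
z ω` with `|ω| ≤ 1`.

Schwarz–Pick for `ω` at `0` says exactly `Re (a₂ w) ≥ -1/2`. Equality makes `ω` explicit, which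
gives `(z - ζ) (z - η) f' = conj (1 / w) (f - w)`. Then `f - w` is a constant times `((z - ζ) / (z -
η)) ^ κ` with `κ > 0`, which blows up at `η`, against boundedness. -/

/-- An injective holomorphic function on the unit disk is an open map there. -/
theorem isOpen_image_of_injOn_ball {f : ℂ → ℂ} (hd : DifferentiableOn ℂ f (ball 0 1))
    (hi : InjOn f (ball 0 1)) {s : Set ℂ} (hs : s ⊆ ball 0 1) (hso : IsOpen s) :
    IsOpen (f '' s) := by
  rcases (hd.analyticOnNhd isOpen_ball).is_constant_or_isOpen
    (convex_ball (0 : ℂ) 1).isPreconnected with ⟨c, hc⟩ | h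
  · have h0 : (0 : ℂ) ∈ ball (0 : ℂ) 1 := by simp
    have h1 : (1 / 2 : ℂ) ∈ ball (0 : ℂ) 1 := by simp; norm_num
    have := hi h0 h1 ((hc _ h0).trans (hc _ h1).symm)
    norm_num at this
  · exact h s hs hso

/-- An injective holomorphic function on the unit disk has nowhere vanishing derivative and a
holomorphic inverse. -/
theorem exists_holomorphic_inverse {f : ℂ → ℂ} (hd : DifferentiableOn ℂ f (ball 0 1))
    (hi : InjOn f (ball 0 1)) :
    ∃ k : ℂ → ℂ, ∀ z ∈ ball (0 : ℂ) 1,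
      k (f z) = z ∧ deriv f z ≠ 0 ∧ HasDerivAt k (deriv f z)⁻¹ (f z) := by
  set D : Set ℂ := ball 0 1 with hD
  have hDo : IsOpen D := isOpen_ball
  set k := Function.invFunOn f D with hk
  have hkf : ∀ z ∈ D, k (f z) = z := fun z hz => hi.leftInvOn_invFunOn hz
  have hfd : ∀ z ∈ D, DifferentiableAt ℂ f z := fun z hz => hd.differentiableAt (hDo.mem_nhds hz)
  have hkc : ∀ z ∈ D, ContinuousAt k (f z) := by
    intro z hz
    rw [ContinuousAt, hkf z hz]
    intro s hs
    obtain ⟨t, hts, hto, hzt⟩ := _root_.mem_nhds_iff.1 (inter_mem hs (hDo.mem_nhds hz))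
    rw [Filter.mem_map]
    refine mem_of_superset ((isOpen_image_of_injOn_ball hd hi
      (fun x hx => (hts hx).2) hto).mem_nhds (mem_image_of_mem f hzt)) ?_
    rintro _ ⟨x, hx, rfl⟩
    simp only [mem_preimage]
    rw [hkf x (hts hx).2]
    exact (hts hx).1
  have hright : ∀ z ∈ D, ∀ᶠ y in 𝓝 (f z), f (k y) = y := by
    intro z hz
    refine mem_of_superset ((isOpen_image_of_injOn_ball hd hi Subset.rfl hDo).mem_nhds
      (mem_image_of_mem f hz)) ?_
    rintro _ ⟨x, hx, rfl⟩
    simp [hkf x hx]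
  have hkd : ∀ z ∈ D, deriv f z ≠ 0 → HasDerivAt k (deriv f z)⁻¹ (f z) := by
    intro z hz h0
    refine HasDerivAt.of_local_left_inverse (hkc z hz) ?_ h0 (hright z hz)
    rw [hkf z hz]
    exact (hfd z hz).hasDerivAt
  -- Zeros of `f'` are isolated, so `k` is holomorphic on a punctured neighbourhood of `f z` and
  -- continuous at `f z`: the singularity is removable.
  have hkdiff : ∀ z ∈ D, DifferentiableAt ℂ k (f z) := by
    intro z hz
    have han : AnalyticAt ℂ (deriv f) z := ((hd.analyticOnNhd hDo) z hz).deriv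
    rcases han.eventually_eq_zero_or_eventually_ne_zero with h | h
    · exfalso
      obtain ⟨e, he, hball⟩ := Metric.mem_nhds_iff.1 (inter_mem h (hDo.mem_nhds hz))
      have hz' : z ∈ ball z e := mem_ball_self he
      have hy' : z + (e / 2 : ℝ) ∈ ball z e := by
        simp [abs_of_pos he, he]
      have hconst := (isOpen_ball (x := z) (ε := e)).is_const_of_deriv_eq_zero
        (convex_ball z e).isPreconnected
        (fun x hx => (hfd x (hball hx).2).differentiableWithinAt) (fun x hx => (hball hx).1) hz' hy'
      have := hi (hball hz').2 (hball hy').2 hconst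
      simp [he.ne'] at this
    · obtain ⟨t, hts, hto, hzt⟩ := _root_.mem_nhds_iff.1
        (inter_mem (eventually_nhdsWithin_iff.1 h) (hDo.mem_nhds hz))
      have hopen := isOpen_image_of_injOn_ball hd hi (fun x hx => (hts hx).2) hto
      have hmem := hopen.mem_nhds (mem_image_of_mem f hzt)
      refine ((Complex.differentiableOn_compl_singleton_and_continuousAt_iff hmem).1
        ⟨?_, hkc z hz⟩).differentiableAt hmem
      rintro _ ⟨⟨x, hx, rfl⟩, hne⟩
      have hxz : x ≠ z := fun h => hne (by simp [h])
      exact (hkd x (hts hx).2 ((hts hx).1 hxz)).differentiableAt.differentiableWithinAt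
  have hne : ∀ z ∈ D, deriv f z ≠ 0 := by
    intro z hz h0
    have h1 : HasDerivAt (k ∘ f) (deriv k (f z) * deriv f z) z :=
      (hkdiff z hz).hasDerivAt.comp z (hfd z hz).hasDerivAt
    have h2 : HasDerivAt (k ∘ f) 1 z := by
      refine (hasDerivAt_id z).congr_of_eventuallyEq ?_
      filter_upwards [hDo.mem_nhds hz] with x hx using hkf x hx
    have := h1.unique h2
    simp [h0] at this
  exact ⟨k, fun z hz => ⟨hkf z hz, hne z hz, hkd z hz (hne z hz)⟩⟩

/-! ### Study's theorem and the Suffridge inequality -/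

theorem HasDerivAt.nonpos_of_le_right {φ : ℝ → ℝ} {d : ℝ} (h : HasDerivAt φ d 0)
    (hle : ∀ t ∈ Ioo (0 : ℝ) 1, φ t ≤ φ 0) : d ≤ 0 := by
  have h1 := (hasDerivAt_iff_tendsto_slope.1 h).mono_left
    (nhdsWithin_mono (0 : ℝ) (s := Ioi 0) (fun x hx => ne_of_gt hx))
  refine le_of_tendsto h1 ?_
  filter_upwards [Ioo_mem_nhdsGT (zero_lt_one' ℝ)] with t ht
  rw [slope_def_field]
  exact div_nonpos_of_nonpos_of_nonneg (by linarith [hle t ht]) (by linarith [ht.1])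

/-- Infinitesimal form of Study's theorem on convexity of the images of subdisks. -/
theorem IsNormalizedConvexMapping.re_conj_mul_div_deriv_nonpos {f : ℂ → ℂ}
    (hf : IsNormalizedConvexMapping f) {x z : ℂ} (hx : ‖x‖ ≤ 1) (hz : z ∈ ball (0 : ℂ) 1) :
    (conj z * ((f (x * z) - f z) / deriv f z)).re ≤ 0 := by
  obtain ⟨k, hk⟩ := exists_holomorphic_inverse hf.differentiableOn hf.injOn
  have hxz : ∀ y ∈ ball (0 : ℂ) 1, x * y ∈ ball (0 : ℂ) 1 := by
    intro y hy
    rw [mem_ball_zero_iff] at hy ⊢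
    rw [norm_mul]
    nlinarith [norm_nonneg y]
  have hfd : ∀ y ∈ ball (0 : ℂ) 1, DifferentiableAt ℂ f y :=
    fun y hy => hf.differentiableOn.differentiableAt (isOpen_ball.mem_nhds hy)
  -- Schwarz lemma: by convexity, pulling back `(1 - t) f y + t f (x y)` through `k` gives a
  -- self-map of the disk fixing `0`. The conclusion is its derivative at `t = 0`.
  have hle : ∀ t ∈ Ioo (0 : ℝ) 1,
      ‖k (f z + (t : ℂ) * (f (x * z) - f z))‖ ≤ ‖z‖ := by
    intro t ht
    have hmem : ∀ y ∈ ball (0 : ℂ) 1, ∃ v ∈ ball (0 : ℂ) 1,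
        f v = f y + (t : ℂ) * (f (x * y) - f y) := by
      intro y hy
      have := hf.convex_image (mem_image_of_mem f hy) (mem_image_of_mem f (hxz y hy))
        (by linarith [ht.2] : 0 ≤ 1 - t) ht.1.le (by ring)
      obtain ⟨v, hv, hvy⟩ := this
      refine ⟨v, hv, hvy.trans ?_⟩
      simp only [Complex.real_smul]
      push_cast
      ring
    refine Complex.norm_le_norm_of_mapsTo_ball (R := 1)
      (f := fun y => k (f y + (t : ℂ) * (f (x * y) - f y))) ?_ ?_ ?_ (mem_ball_zero_iff.1 hz)
    · intro y hy
      obtain ⟨v, hv, hvy⟩ := hmem y hy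
      have h1 := (hk v hv).2.2.differentiableAt
      rw [hvy] at h1
      have h2 : DifferentiableAt ℂ (fun y => f y + (t : ℂ) * (f (x * y) - f y)) y := by
        have h3 : DifferentiableAt ℂ (fun y => f (x * y)) y :=
          (hfd _ (hxz y hy)).comp y (by fun_prop)
        exact (hfd y hy).add ((h3.sub (hfd y hy)).const_mul _)
      exact (h1.comp y h2).differentiableWithinAt
    · intro y hy
      obtain ⟨v, hv, hvy⟩ := hmem y hy
      simp only
      rw [← hvy, (hk v hv).1]
      exact ball_subset_closedBall hv
    · simp only [mul_zero, hf.map_zero, sub_zero, add_zero]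
      simpa [hf.map_zero] using (hk 0 (by simp)).1
  set e := f (x * z) - f z with he
  have hc : HasDerivAt (fun t : ℝ => k (f z + (t : ℂ) * e)) ((deriv f z)⁻¹ * e) 0 := by
    have h1 : HasDerivAt (fun t : ℂ => f z + t * e) e ((0 : ℝ) : ℂ) := by
      simpa using ((hasDerivAt_id ((0 : ℝ) : ℂ)).mul_const e).const_add (f z)
    have h2 : HasDerivAt k (deriv f z)⁻¹ (f z + ((0 : ℝ) : ℂ) * e) := by
      simpa using (hk z hz).2.2
    exact (h2.comp ((0 : ℝ) : ℂ) h1).comp_ofReal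
  have hn := hc.norm_sq
  have h3 := hn.nonpos_of_le_right (fun t ht => by
    have := hle t ht
    simp only [Complex.ofReal_zero, zero_mul, add_zero, (hk z hz).1]
    gcongr)
  simp only [Complex.ofReal_zero, zero_mul, add_zero, (hk z hz).1] at h3
  rw [Complex.inner] at h3
  have h4 : conj z * (e / deriv f z) = (deriv f z)⁻¹ * e * conj z := by ring
  rw [h4]
  linarith

theorem Complex.re_add_div_sub_of_norm_eq {y c : ℂ} (h : ‖y‖ = ‖c‖) :
    ((y + c) / (y - c)).re = 0 := by
  have h2 : Complex.normSq y = Complex.normSq c := by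
    rw [Complex.normSq_eq_norm_sq, Complex.normSq_eq_norm_sq, h]
  rw [Complex.normSq_apply, Complex.normSq_apply] at h2
  rw [Complex.div_re, ← add_div]
  have : (y + c).re * (y - c).re + (y + c).im * (y - c).im = 0 := by
    simp only [Complex.add_re, Complex.sub_re, Complex.add_im, Complex.sub_im]
    linarith
  rw [this, zero_div]

/-- A function holomorphic near a closed disk whose real part is nonnegative on the boundary circle
has nonnegative real part inside. -/
theorem re_nonneg_of_re_nonneg_on_sphere {F : ℂ → ℂ} {r : ℝ} (hr : 0 < r)
    (hd : DifferentiableOn ℂ F (closedBall 0 r)) (hb : ∀ y : ℂ, ‖y‖ = r → 0 ≤ (F y).re)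
    {z : ℂ} (hz : ‖z‖ < r) : 0 ≤ (F z).re := by
  -- `|exp (-F)| = exp (-Re F)` turns the claim into the maximum modulus principle.
  have h1 : DifferentiableOn ℂ (fun y => Complex.exp (-F y)) (closedBall 0 r) := hd.neg.cexp
  have h2 := Complex.norm_le_of_forall_mem_frontier_norm_le (isBounded_ball (x := (0 : ℂ)) (r := r))
    (DifferentiableOn.diffContOnCl_ball h1 Subset.rfl) (C := 1) (fun y hy => by
      rw [frontier_ball _ hr.ne', mem_sphere_zero_iff_norm] at hy
      rw [Complex.norm_exp, Real.exp_le_one_iff, Complex.neg_re]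
      linarith [hb y hy])
    (subset_closure (mem_ball_zero_iff.2 hz))
  rw [Complex.norm_exp, Real.exp_le_one_iff, Complex.neg_re] at h2
  linarith

/-- The Sheil-Small–Suffridge inequality for convex mappings. -/
theorem IsNormalizedConvexMapping.re_suffridge_nonneg {f : ℂ → ℂ}
    (hf : IsNormalizedConvexMapping f) {c z : ℂ} (hc : c ∈ ball (0 : ℂ) 1) (hz : ‖z‖ < ‖c‖) :
    0 ≤ (2 * z * deriv f z / (f z - f c) - (z + c) / (z - c)).re := by
  obtain ⟨k, hk⟩ := exists_holomorphic_inverse hf.differentiableOn hf.injOn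
  have hne : ∀ y ∈ ball (0 : ℂ) 1, deriv f y ≠ 0 := fun y hy => (hk y hy).2.1
  have hDo : IsOpen (ball (0 : ℂ) 1) := isOpen_ball
  have hcn := hDo.mem_nhds hc
  have hc0 : c ≠ 0 := norm_pos_iff.1 ((norm_nonneg z).trans_lt hz)
  have hcl : closedBall (0 : ℂ) ‖c‖ ⊆ ball 0 1 :=
    closedBall_subset_ball (mem_ball_zero_iff.1 hc)
  set q := dslope f c with hq
  have hqd : DifferentiableOn ℂ q (ball 0 1) :=
    (Complex.differentiableOn_dslope hcn).2 hf.differentiableOn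
  have hq_ne : ∀ y, y ≠ c → q y = (f y - f c) / (y - c) := fun y hy => by
    rw [hq, dslope_of_ne _ hy, slope_def_field]
  have hsub : ∀ y ∈ ball (0 : ℂ) 1, y ≠ c → f y - f c ≠ 0 := fun y hy h h0 =>
    h (hf.injOn hy hc (sub_eq_zero.1 h0))
  have hq0 : ∀ y ∈ ball (0 : ℂ) 1, q y ≠ 0 := by
    intro y hy
    by_cases h : y = c
    · rw [h, hq, dslope_same]; exact hne c hc
    · rw [hq_ne y h]
      exact div_ne_zero (hsub y hy h) (sub_ne_zero.2 h)
  -- The two terms have the same residue `2 c` at `c`, so their difference `N y / (y - c)` extends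
  -- holomorphically, as a `dslope`.
  set N : ℂ → ℂ := fun y => 2 * y * deriv f y / q y - (y + c) with hN
  have hNd : DifferentiableOn ℂ N (ball 0 1) :=
    (((differentiableOn_id.const_mul 2).mul (hf.differentiableOn.deriv hDo)).div hqd hq0).sub
      (differentiableOn_id.add_const c)
  have hNc : N c = 0 := by
    simp only [hN, hq, dslope_same]
    field_simp [hne c hc]
    ring
  set F := dslope N c with hF
  have hFd : DifferentiableOn ℂ F (ball 0 1) := (Complex.differentiableOn_dslope hcn).2 hNd
  have hF_eq : ∀ y ∈ ball (0 : ℂ) 1, y ≠ c →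
      F y = 2 * y * deriv f y / (f y - f c) - (y + c) / (y - c) := by
    intro y hy h
    have h1 := sub_ne_zero.2 h
    have h2 := hsub y hy h
    rw [hF, dslope_of_ne _ h, slope_def_field, hNc, sub_zero]
    simp only [hN]
    rw [hq_ne y h]
    field_simp
  -- On this circle the Möbius term is purely imaginary; the other is controlled by Study's
  -- inequality with `x = c / y`.
  have hb' : ∀ y : ℂ, ‖y‖ = ‖c‖ → y ≠ c → 0 ≤ (F y).re := by
    intro y hy h
    have hyD : y ∈ ball (0 : ℂ) 1 := hcl (mem_closedBall_zero_iff.2 hy.le)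
    have hy0 : y ≠ 0 := by rw [← norm_pos_iff, hy, norm_pos_iff]; exact hc0
    rw [hF_eq y hyD h, Complex.sub_re, Complex.re_add_div_sub_of_norm_eq hy, sub_zero]
    have h1 := hf.re_conj_mul_div_deriv_nonpos (x := c / y) (z := y)
      (by rw [norm_div, hy, div_self (norm_ne_zero_iff.2 hc0)]) hyD
    rw [div_mul_cancel₀ _ hy0] at h1
    have h2 := hsub y hyD h
    have h3 := hne y hyD
    set v := (f c - f y) / deriv f y with hv
    have h4 : 2 * y * deriv f y / (f y - f c) = -(2 * y / v) := by
      have : f c - f y ≠ 0 := by rw [← neg_sub]; exact neg_ne_zero.2 h2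
      rw [hv]
      field_simp
      ring
    rw [h4, Complex.neg_re, Complex.div_re, ← add_div, ← neg_div]
    refine div_nonneg ?_ (Complex.normSq_nonneg _)
    simp at h1 ⊢
    linarith
  have hb : ∀ y : ℂ, ‖y‖ = ‖c‖ → 0 ≤ (F y).re := by
    intro y hy
    by_cases h : y = c
    · have hder : HasDerivAt (fun s : ℝ => c * Complex.exp (s * Complex.I)) (c * Complex.I) 0 := by
        have : HasDerivAt (fun s : ℂ => c * Complex.exp (s * Complex.I)) (c * Complex.I)
            ((0 : ℝ) : ℂ) := by
          simpa using (((hasDerivAt_id ((0 : ℝ) : ℂ)).mul_const Complex.I).cexp).const_mul c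
        exact this.comp_ofReal
      have hev := hder.eventually_ne (c := c) (mul_ne_zero hc0 Complex.I_ne_zero)
      have hcont : ContinuousAt (fun s : ℝ => (F (c * Complex.exp (s * Complex.I))).re) 0 := by
        have h1 : ContinuousAt F c := (hFd.differentiableAt hcn).continuousAt
        refine Complex.continuous_re.continuousAt.comp ?_
        refine ContinuousAt.comp (g := F) ?_ hder.continuousAt
        simpa using h1
      have hlim := hcont.tendsto.mono_left (nhdsWithin_le_nhds (s := {(0 : ℝ)}ᶜ))
      simp only [Complex.ofReal_zero, zero_mul, Complex.exp_zero, mul_one] at hlim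
      rw [h]
      refine ge_of_tendsto hlim ?_
      filter_upwards [hev] with s hs
      refine hb' _ ?_ hs
      rw [norm_mul, Complex.norm_exp_ofReal_mul_I, mul_one]
    · exact hb' y hy h
  have hzc : z ≠ c := fun h => by simp [h] at hz
  have := re_nonneg_of_re_nonneg_on_sphere (norm_pos_iff.2 hc0) (hFd.mono hcl) hb hz
  rwa [hF_eq z (hcl (mem_closedBall_zero_iff.2 hz.le)) hzc] at this

/-! ### Rigidity in Schwarz–Pick and the extremal differential equation -/

/-- Equality case of the Schwarz–Pick lemma at the origin. -/
theorem mul_one_add_eq_of_schwarzPick_eq {ω : ℂ → ℂ} (hd : DifferentiableOn ℂ ω (ball 0 1))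
    (hle : ∀ z ∈ ball (0 : ℂ) 1, ‖ω z‖ ≤ 1) {ε : ℂ} (hε : ‖ε‖ = 1)
    (heq : 1 - ‖ω 0‖ ^ 2 ≤ (conj ε * deriv ω 0).re) {z : ℂ} (hz : z ∈ ball (0 : ℂ) 1) :
    ω z * (1 + conj (ω 0) * ε * z) = ω 0 + ε * z := by
  have h0 : (0 : ℂ) ∈ ball (0 : ℂ) 1 := by simp
  set α := ω 0 with hα
  have hα1 : ‖α‖ ≤ 1 := hle 0 h0
  rcases hα1.eq_or_lt with h1 | h1
  · have hconst : ω z = α := by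
      refine Complex.eqOn_of_isPreconnected_of_isMaxOn_norm
        (convex_ball (0 : ℂ) 1).isPreconnected isOpen_ball hd h0 ?_ hz
      intro y hy
      simp only [mem_ofPred_eq, Function.comp_apply]
      rw [← hα, h1]
      exact hle y hy
    have h2 : α * conj α = 1 := by rw [Complex.mul_conj, Complex.normSq_eq_norm_sq, h1]; simp
    rw [hconst]
    linear_combination ε * z * h2
  · have hden : ∀ y ∈ ball (0 : ℂ) 1, 1 - conj α * ω y ≠ 0 := by
      intro y hy h
      have h2 : ‖conj α * ω y‖ = 1 := by rw [← sub_eq_zero.1 h, norm_one]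
      rw [norm_mul, Complex.norm_conj] at h2
      nlinarith [hle y hy, norm_nonneg α, norm_nonneg (ω y)]
    -- Moving `α` to `0` reduces to Schwarz: the hypothesis forces `ψ' 0 = ε`, hence `ψ z = ε z`.
    set ψ : ℂ → ℂ := fun y => (ω y - α) / (1 - conj α * ω y) with hψ
    have hψd : DifferentiableOn ℂ ψ (ball 0 1) :=
      (hd.sub_const α).div ((hd.const_mul _).const_sub 1) hden
    have hψ0 : ψ 0 = 0 := by simp [hψ, ← hα]
    have hnum : ∀ a b : ℂ, ‖a‖ ≤ 1 → ‖b‖ ≤ 1 → ‖b - a‖ ≤ ‖1 - conj a * b‖ := by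
      intro a b ha hb
      rw [← sq_le_sq₀ (norm_nonneg _) (norm_nonneg _)]
      have ha2 : ‖a‖ ^ 2 ≤ 1 := by nlinarith [norm_nonneg a]
      have hb2 : ‖b‖ ^ 2 ≤ 1 := by nlinarith [norm_nonneg b]
      rw [← Complex.normSq_eq_norm_sq, Complex.normSq_apply] at ha2 hb2 ⊢
      rw [← Complex.normSq_eq_norm_sq, Complex.normSq_apply]
      simp
      nlinarith [mul_nonneg (sub_nonneg.2 ha2) (sub_nonneg.2 hb2)]
    have hmaps : MapsTo ψ (ball 0 1) (closedBall (ψ 0) 1) := by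
      intro y hy
      rw [hψ0, mem_closedBall_zero_iff]
      simp only [hψ]
      rw [norm_div]
      exact div_le_one_of_le₀ (hnum α (ω y) hα1 (hle y hy)) (norm_nonneg _)
    have hS : 0 < 1 - ‖α‖ ^ 2 := by nlinarith [norm_nonneg α]
    have hαα : 1 - conj α * α = ((1 - ‖α‖ ^ 2 : ℝ) : ℂ) := by
      rw [mul_comm, Complex.mul_conj, Complex.normSq_eq_norm_sq]; push_cast; ring
    have hderiv : deriv ψ 0 = deriv ω 0 / ((1 - ‖α‖ ^ 2 : ℝ) : ℂ) := by
      have hω := (hd.differentiableAt (isOpen_ball.mem_nhds h0)).hasDerivAt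
      have := (hω.sub_const α).div ((hω.const_mul (conj α)).const_sub 1) (hden 0 h0)
      have h2 := this.deriv
      have h3 := hden 0 h0
      rw [← hα] at h2 h3
      rw [show deriv ψ 0 = _ from h2, ← hαα]
      field_simp
      ring
    have hnorm : ‖deriv ψ 0‖ ≤ 1 := Complex.norm_deriv_le_one_of_mapsTo_ball hψd hmaps one_pos
    have hre : 1 ≤ (conj ε * deriv ψ 0).re := by
      rw [hderiv, ← mul_div_assoc, Complex.div_ofReal_re, le_div_iff₀ hS, one_mul]
      exact heq
    have hψε : deriv ψ 0 = ε := by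
      have h2 : ‖conj ε * deriv ψ 0‖ ≤ 1 := by
        rw [norm_mul, Complex.norm_conj, hε, one_mul]; exact hnorm
      have h3 : conj ε * deriv ψ 0 = 1 := by
        have h4 := Complex.sq_norm (conj ε * deriv ψ 0)
        rw [Complex.normSq_apply] at h4
        have h5 : ‖conj ε * deriv ψ 0‖ ^ 2 ≤ 1 := by nlinarith [norm_nonneg (conj ε * deriv ψ 0)]
        have h6 : (conj ε * deriv ψ 0).re = 1 :=
          le_antisymm ((Complex.re_le_norm _).trans h2) hre
        apply Complex.ext
        · simpa using h6
        · rw [h6] at h4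
          simp only [Complex.one_im]
          nlinarith [sq_nonneg (conj ε * deriv ψ 0).im]
      have h7 : ε * conj ε = 1 := by
        rw [Complex.mul_conj, Complex.normSq_eq_norm_sq, hε]; simp
      linear_combination ε * h3 - deriv ψ 0 * h7
    have haff := Complex.affine_of_mapsTo_ball_of_norm_dslope_eq_div hψd hmaps h0
      (by rw [dslope_same, hψε, hε]; simp) hz
    simp only [hψ0, dslope_same, hψε, sub_zero, zero_add, smul_eq_mul] at haff
    rw [hψ, div_eq_iff (hden z hz)] at haff
    linear_combination haff

/-- A nonzero solution on the unit disk of `g' = κ (1 / (z - ζ) - 1 / (z - η)) g`, with `κ > 0` and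
`ζ ≠ η` on the unit circle, is unbounded. -/
theorem eq_zero_of_bounded_of_deriv_eq {g : ℂ → ℂ} (hd : DifferentiableOn ℂ g (ball 0 1))
    {M : ℝ} (hM : ∀ z ∈ ball (0 : ℂ) 1, ‖g z‖ ≤ M) {ζ η : ℂ} (hζ : ‖ζ‖ = 1) (hη : ‖η‖ = 1)
    (hne : ζ ≠ η) {κ : ℝ} (hκ : 0 < κ)
    (hode : ∀ z ∈ ball (0 : ℂ) 1, deriv g z = κ * (1 / (z - ζ) - 1 / (z - η)) * g z) :
    g 0 = 0 := by
  have hunit : ∀ c : ℂ, ‖c‖ = 1 → conj c * c = 1 := fun c hc => by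
    rw [mul_comm, Complex.mul_conj, Complex.normSq_eq_norm_sq, hc]; simp
  have hslit : ∀ c : ℂ, ‖c‖ = 1 → ∀ z ∈ ball (0 : ℂ) 1, 1 - conj c * z ∈ Complex.slitPlane := by
    intro c hc z hz
    left
    rw [mem_ball_zero_iff] at hz
    have h1 : (conj c * z).re ≤ ‖z‖ := by
      refine (Complex.re_le_norm _).trans ?_
      rw [norm_mul, Complex.norm_conj, hc, one_mul]
    simp only [Complex.sub_re, Complex.one_re]
    linarith
  have hlog : ∀ c : ℂ, ‖c‖ = 1 → ∀ z ∈ ball (0 : ℂ) 1,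
      HasDerivAt (fun y => Complex.log (1 - conj c * y)) (1 / (z - c)) z := by
    intro c hc z hz
    have h1 := (((hasDerivAt_id z).const_mul (conj c)).const_sub 1).clog (hslit c hc z hz)
    refine h1.congr_deriv ?_
    have h2 : z - c ≠ 0 := fun h => by
      rw [sub_eq_zero.1 h, mem_ball_zero_iff, hc] at hz
      exact lt_irrefl _ hz
    have h3 := Complex.slitPlane_ne_zero (hslit c hc z hz)
    simp only [id]
    rw [div_eq_div_iff h3 h2]
    linear_combination hunit c hc
  -- Integrating factor: `P` is constant, and evaluating it along the radius to `η` forces `g 0 =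
  -- 0`.
  set P : ℂ → ℂ := fun z =>
    g z * Complex.exp (κ * (Complex.log (1 - conj η * z) - Complex.log (1 - conj ζ * z))) with hP
  have hPd : ∀ z ∈ ball (0 : ℂ) 1, HasDerivAt P 0 z := by
    intro z hz
    have h1 := (hd.differentiableAt (isOpen_ball.mem_nhds hz)).hasDerivAt
    have h2 := h1.mul ((((hlog η hη z hz).sub (hlog ζ hζ z hz)).const_mul (κ : ℂ)).cexp)
    refine h2.congr_deriv ?_
    rw [hode z hz]
    simp only [Pi.sub_apply]
    ring
  have hconst : ∀ z ∈ ball (0 : ℂ) 1, P z = g 0 := by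
    intro z hz
    have := isOpen_ball.is_const_of_deriv_eq_zero (convex_ball (0 : ℂ) 1).isPreconnected
      (fun y hy => (hPd y hy).differentiableAt.differentiableWithinAt)
      (fun y hy => (hPd y hy).deriv) hz (mem_ball_self one_pos)
    rw [this]
    simp [hP]
  have hbound : ∀ r ∈ Ioo (0 : ℝ) 1,
      ‖g 0‖ ≤ M * ((1 - r) / ‖1 - conj ζ * (r * η)‖) ^ κ := by
    intro r hr
    have hz : (r : ℂ) * η ∈ ball (0 : ℂ) 1 := by
      rw [mem_ball_zero_iff, norm_mul, hη, Complex.norm_real, Real.norm_of_nonneg hr.1.le, mul_one]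
      exact hr.2
    rw [← hconst _ hz]
    simp only [hP]
    rw [norm_mul]
    refine mul_le_mul (hM _ hz) ?_ (norm_nonneg _) ((norm_nonneg _).trans (hM _ hz))
    have h1 : 1 - conj η * (r * η) = ((1 - r : ℝ) : ℂ) := by
      push_cast
      linear_combination (-r : ℂ) * hunit η hη
    have h2 : 0 < ‖1 - conj ζ * (r * η)‖ :=
      norm_pos_iff.2 (Complex.slitPlane_ne_zero (hslit ζ hζ _ hz))
    have h3 : 0 < 1 - r := by linarith [hr.2]
    rw [Complex.norm_exp, Complex.re_ofReal_mul, Complex.sub_re, Complex.log_re, Complex.log_re, h1,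
      Complex.norm_real, Real.norm_of_nonneg h3.le, Real.rpow_def_of_pos (div_pos h3 h2),
      Real.log_div h3.ne' h2.ne', mul_comm]
  have hlim : Tendsto (fun r : ℝ => M * ((1 - r) / ‖1 - conj ζ * (r * η)‖) ^ κ) (𝓝[<] 1) (𝓝 0) := by
    have h1 : ‖1 - conj ζ * (((1 : ℝ) : ℂ) * η)‖ ≠ 0 := by
      rw [norm_ne_zero_iff]
      intro h
      apply hne
      push_cast at h
      linear_combination ζ * h + η * hunit ζ hζ
    have h2 : ContinuousAt (fun r : ℝ => M * ((1 - r) / ‖1 - conj ζ * (r * η)‖) ^ κ) 1 := by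
      refine ContinuousAt.mul continuousAt_const (ContinuousAt.rpow_const ?_ (Or.inr hκ.le))
      exact ContinuousAt.div (by fun_prop) (by fun_prop) h1
    have h3 := h2.tendsto.mono_left (nhdsWithin_le_nhds (s := Iio (1 : ℝ)))
    simpa [Real.zero_rpow hκ.ne'] using h3
  have : ‖g 0‖ ≤ 0 := by
    refine ge_of_tendsto hlim ?_
    filter_upwards [Ioo_mem_nhdsLT (zero_lt_one' ℝ)] with r hr using hbound r hr
  exact norm_le_zero_iff.1 this

/-! ### The Schur function at a boundary point -/

/-- The Schur function attached to a convex mapping `f` and a boundary value `w` of `f` at the point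
`ζ` of the unit circle. -/
noncomputable def boundarySchurFunction (f : ℂ → ℂ) (ζ w z : ℂ) : ℂ :=
  (deriv f z * (z - ζ) - (f z - w)) / (z * deriv f z * (z - ζ) - ζ * (f z - w))

section

variable {f : ℂ → ℂ} (hf : IsNormalizedConvexMapping f) {ζ w : ℂ} (hζ : ‖ζ‖ = 1)
  (hw : ∀ z ∈ ball (0 : ℂ) 1, f z ≠ w)
  (hpos : ∀ z ∈ ball (0 : ℂ) 1, 0 ≤ (2 * z * deriv f z / (f z - w) - (z + ζ) / (z - ζ)).re)

include hζ in
theorem sub_ne_zero_of_mem_ball {z : ℂ} (hz : z ∈ ball (0 : ℂ) 1) : z - ζ ≠ 0 := fun h => by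
  rw [sub_eq_zero.1 h, mem_ball_zero_iff, hζ] at hz
  exact lt_irrefl _ hz

include hζ hw hpos in
-- A zero would make the function with nonnegative real part equal to `-1`.
theorem boundarySchurFunction_denom_ne_zero {z : ℂ} (hz : z ∈ ball (0 : ℂ) 1) :
    z * deriv f z * (z - ζ) - ζ * (f z - w) ≠ 0 := by
  intro h
  have h1 := sub_ne_zero_of_mem_ball hζ hz
  have h2 := sub_ne_zero.2 (hw z hz)
  have h3 : 2 * z * deriv f z / (f z - w) - (z + ζ) / (z - ζ) = -1 := by
    field_simp
    linear_combination 2 * h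
  have := hpos z hz
  rw [h3] at this
  norm_num at this

include hf hζ hw hpos in
theorem differentiableOn_boundarySchurFunction :
    DifferentiableOn ℂ (boundarySchurFunction f ζ w) (ball 0 1) := by
  have h1 := hf.differentiableOn
  have h2 := h1.deriv isOpen_ball
  have h3 : DifferentiableOn ℂ (fun z => z - ζ) (ball (0 : ℂ) 1) := by fun_prop
  have h4 : DifferentiableOn ℂ (fun z => z) (ball (0 : ℂ) 1) := by fun_prop
  exact ((h2.mul h3).sub (h1.sub_const w)).div
    (((h4.mul h2).mul h3).sub ((h1.sub_const w).const_mul ζ))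
    (fun z hz => boundarySchurFunction_denom_ne_zero hζ hw hpos hz)

theorem norm_sub_one_le_norm_add_one {F : ℂ} (h : 0 ≤ F.re) : ‖F - 1‖ ≤ ‖F + 1‖ := by
  rw [← sq_le_sq₀ (norm_nonneg _) (norm_nonneg _), ← Complex.normSq_eq_norm_sq,
    ← Complex.normSq_eq_norm_sq, Complex.normSq_apply, Complex.normSq_apply]
  simp
  nlinarith

include hf hζ hw hpos in
-- With `F` the function in `hpos`, `z ω = (F - 1) / (F + 1)` has modulus at most `1` and vanishes
-- at `0`; the Schwarz lemma removes the factor `z`.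
theorem norm_boundarySchurFunction_le_one {z : ℂ} (hz : z ∈ ball (0 : ℂ) 1) :
    ‖boundarySchurFunction f ζ w z‖ ≤ 1 := by
  have hωd := differentiableOn_boundarySchurFunction hf hζ hw hpos
  set ω := boundarySchurFunction f ζ w with hω
  have hle : ∀ y ∈ ball (0 : ℂ) 1, ‖y * ω y‖ ≤ 1 := by
    intro y hy
    have h1 := sub_ne_zero_of_mem_ball hζ hy
    have h2 := sub_ne_zero.2 (hw y hy)
    have h3 := boundarySchurFunction_denom_ne_zero hζ hw hpos hy
    have h4 := norm_sub_one_le_norm_add_one (hpos y hy)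
    set F := 2 * y * deriv f y / (f y - w) - (y + ζ) / (y - ζ) with hF
    have h5 : F + 1 = 2 * (y * deriv f y * (y - ζ) - ζ * (f y - w)) / ((f y - w) * (y - ζ)) := by
      rw [hF]; field_simp; ring
    have h6 : F - 1 = y * ω y * (F + 1) := by
      have h8 : ω y * (y * deriv f y * (y - ζ) - ζ * (f y - w)) =
          deriv f y * (y - ζ) - (f y - w) := div_mul_cancel₀ _ h3
      have h9 : F - 1 =
          2 * y * (deriv f y * (y - ζ) - (f y - w)) / ((f y - w) * (y - ζ)) := by
        rw [hF]; field_simp; ring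
      rw [h5, h9, ← h8]
      ring
    have h7 : F + 1 ≠ 0 := by
      rw [h5]
      exact div_ne_zero (mul_ne_zero two_ne_zero h3) (mul_ne_zero h2 h1)
    rw [h6, norm_mul] at h4
    exact le_of_mul_le_mul_right (by linarith) (norm_pos_iff.2 h7)
  have hd : DifferentiableOn ℂ (fun y => y * ω y) (ball 0 1) := differentiableOn_id.mul hωd
  have hmaps : MapsTo (fun y => y * ω y) (ball 0 1) (closedBall ((fun y => y * ω y) 0) 1) := by
    intro y hy
    simpa using hle y hy
  have := Complex.norm_dslope_le_div_of_mapsTo_ball hd hmaps hz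
  have h8 : dslope (fun y => y * ω y) 0 z = ω z := by
    by_cases h : z = 0
    · have h9 := (hasDerivAt_id (0 : ℂ)).mul
        (hωd.differentiableAt (isOpen_ball.mem_nhds (mem_ball_self one_pos))).hasDerivAt
      rw [h, dslope_same, show deriv (fun y => y * ω y) 0 = _ from h9.deriv]
      simp
    · rw [dslope_of_ne _ h, slope_def_field]
      simp only [zero_mul, sub_zero]
      field_simp
  rwa [h8, div_one] at this

include hf in
theorem boundarySchurFunction_zero (hζ0 : ζ ≠ 0) (hw0 : w ≠ 0) :
    boundarySchurFunction f ζ w 0 = 1 / ζ - 1 / w := by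
  simp only [boundarySchurFunction, hf.map_zero, hf.deriv_zero]
  field_simp
  ring

include hf in
theorem deriv_boundarySchurFunction_zero (hζ0 : ζ ≠ 0) (hw0 : w ≠ 0) :
    deriv (boundarySchurFunction f ζ w) 0 =
      2 * (1 / w) * (1 / ζ - 1 / w - taylorCoeffAtZero f 2) := by
  have h0 := isOpen_ball.mem_nhds (mem_ball_self (x := (0 : ℂ)) one_pos)
  have h1 := (hf.differentiableOn.differentiableAt h0).hasDerivAt
  have h2 := ((hf.differentiableOn.deriv isOpen_ball).differentiableAt h0).hasDerivAt
  have h3 := (hasDerivAt_id (0 : ℂ)).sub_const ζ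
  have h4 := ((h2.mul h3).sub (h1.sub_const w)).div
    ((((hasDerivAt_id (0 : ℂ)).mul h2).mul h3).sub ((h1.sub_const w).const_mul ζ))
    (by simp [hf.map_zero, hζ0, hw0])
  have h5 : deriv (boundarySchurFunction f ζ w) 0 = _ := h4.deriv
  have h6 : taylorCoeffAtZero f 2 = deriv (deriv f) 0 / 2 := by
    simp [taylorCoeffAtZero, iteratedDeriv_succ, iteratedDeriv_zero]
  rw [h5, h6]
  simp [hf.map_zero, hf.deriv_zero]
  field_simp
  ring

end

/-! ### Strict inequality at boundary values, and the conclusion -/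

/-- A bounded convex mapping with boundary value `w` at a point of the unit circle satisfies
`-1/2 < Re (a₂ w)`. -/
theorem IsNormalizedConvexMapping.neg_half_lt_re_of_boundary {f : ℂ → ℂ}
    (hf : IsNormalizedConvexMapping f) {M : ℝ} (hM : ∀ z ∈ ball (0 : ℂ) 1, ‖f z‖ ≤ M)
    {ζ w : ℂ} (hζ : ‖ζ‖ = 1) (hw : ∀ z ∈ ball (0 : ℂ) 1, f z ≠ w)
    (hpos : ∀ z ∈ ball (0 : ℂ) 1, 0 ≤ (2 * z * deriv f z / (f z - w) - (z + ζ) / (z - ζ)).re) :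
    -(1 / 2 : ℝ) < (taylorCoeffAtZero f 2 * w).re := by
  by_contra! hcon
  have h0 : (0 : ℂ) ∈ ball (0 : ℂ) 1 := mem_ball_self one_pos
  have hw0 : w ≠ 0 := fun h => hw 0 h0 (by rw [hf.map_zero, h])
  have hζ0 : ζ ≠ 0 := by rw [← norm_ne_zero_iff, hζ]; exact one_ne_zero
  have hζζ : conj ζ * ζ = 1 := by
    rw [mul_comm, Complex.mul_conj, Complex.normSq_eq_norm_sq, hζ]; simp
  have hωd := differentiableOn_boundarySchurFunction hf hζ hw hpos
  have hωle : ∀ z ∈ ball (0 : ℂ) 1, ‖boundarySchurFunction f ζ w z‖ ≤ 1 :=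
    fun z hz => norm_boundarySchurFunction_le_one hf hζ hw hpos hz
  have hω0 := boundarySchurFunction_zero hf hζ0 hw0
  have hω1 := deriv_boundarySchurFunction_zero hf hζ0 hw0
  have hωeq : ∀ z ∈ ball (0 : ℂ) 1, boundarySchurFunction f ζ w z *
      (z * deriv f z * (z - ζ) - ζ * (f z - w)) = deriv f z * (z - ζ) - (f z - w) := fun z hz =>
    div_mul_cancel₀ _ (boundarySchurFunction_denom_ne_zero hζ hw hpos hz)
  set ω := boundarySchurFunction f ζ w with hω
  set a := taylorCoeffAtZero f 2 with ha
  obtain ⟨p, hp⟩ : ∃ p, p = 1 / w := ⟨_, rfl⟩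
  have hp0 : p ≠ 0 := by rw [hp]; exact one_div_ne_zero hw0
  have hpc0 : conj p ≠ 0 := (map_ne_zero _).2 hp0
  have hpw : p * w = 1 := by rw [hp]; field_simp
  have hu : 1 / ζ = conj ζ := by rw [div_eq_iff hζ0, hζζ]
  rw [← hp, hu] at hω0 hω1
  have hpn : 0 < Complex.normSq p := Complex.normSq_pos.2 hp0
  have hω0sq : ‖ω 0‖ ^ 2 = 1 - 2 * (p * ζ).re + Complex.normSq p := by
    have h1 : Complex.normSq ζ = 1 := by rw [Complex.normSq_eq_norm_sq, hζ]; norm_num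
    rw [← Complex.normSq_eq_norm_sq, hω0, Complex.normSq_sub, Complex.normSq_conj, h1]
    simp
    ring
  -- `|ω 0| ≤ 1` gives `2 Re (p ζ) ≥ |p|² > 0`; this yields both `ζ ≠ η` and `κ > 0` below.
  have hre : 0 < 2 * (p * ζ).re := by
    have := hωle 0 h0
    have h2 : ‖ω 0‖ ^ 2 ≤ 1 := by nlinarith [norm_nonneg (ω 0)]
    linarith
  -- With this rotation `conj ε * p = conj p`, and `a * conj p = |p|² a w`, so `Re (a w)` appears in
  -- Schwarz–Pick.
  set ε := p / conj p with hε
  have hε1 : ‖ε‖ = 1 := by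
    rw [hε, norm_div, Complex.norm_conj, div_self (norm_ne_zero_iff.2 hp0)]
  have hε0 : ε ≠ 0 := div_ne_zero hp0 hpc0
  have hεp : ε * conj p = p := div_mul_cancel₀ _ hpc0
  have hextremal : 1 - ‖ω 0‖ ^ 2 ≤ (conj ε * deriv ω 0).re := by
    have h1 : conj ε * deriv ω 0 = 2 * (conj ζ - p - a) * conj p := by
      rw [hω1, hε, map_div₀, Complex.conj_conj]
      field_simp
    have h2 : a * conj p = Complex.normSq p * (a * w) := by
      rw [← Complex.mul_conj]
      linear_combination -(a * conj p) * hpw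
    have h3 : 2 * (conj ζ - p - a) * conj p =
        2 * conj (p * ζ) - 2 * (Complex.normSq p : ℂ) - 2 * (a * conj p) := by
      rw [← Complex.mul_conj, map_mul]; ring
    have h4 : (2 * conj (p * ζ) - 2 * (Complex.normSq p : ℂ) - 2 * (a * conj p)).re =
        2 * (p * ζ).re - 2 * Complex.normSq p - 2 * (Complex.normSq p * (a * w).re) := by
      rw [h2, ← Complex.re_ofReal_mul]
      simp
    rw [h1, h3, h4, hω0sq]
    nlinarith
  have hrigid : ∀ z ∈ ball (0 : ℂ) 1,
      ω z * (1 + conj (ω 0) * ε * z) = ω 0 + ε * z := fun z hz =>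
    mul_one_add_eq_of_schwarzPick_eq hωd hωle hε1 hextremal hz
  -- The root other than `ζ` of the quadratic left after substituting the extremal `ω` into its
  -- definition (`h7`).
  set η := -(conj p * conj ζ / p) with hη
  have hη1 : ‖η‖ = 1 := by
    rw [hη, norm_neg, norm_div, norm_mul, Complex.norm_conj, Complex.norm_conj, hζ, mul_one,
      div_self (norm_ne_zero_iff.2 hp0)]
  have hsum : p * ζ + conj p * conj ζ = ((2 * (p * ζ).re : ℝ) : ℂ) := by
    rw [← map_mul, Complex.add_conj]
  have hζη : ζ - η = ((2 * (p * ζ).re : ℝ) : ℂ) / p := by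
    rw [← hsum, hη]; field_simp; ring
  have hζη0 : ζ - η ≠ 0 := by
    rw [hζη]; exact div_ne_zero (Complex.ofReal_ne_zero.2 hre.ne') hp0
  have hode : ∀ z ∈ ball (0 : ℂ) 1, (z - ζ) * (z - η) * deriv f z = conj p * (f z - w) := by
    intro z hz
    have h1 := hrigid z hz
    have h2 := hωeq z hz
    have h3 := sub_ne_zero_of_mem_ball hζ hz
    rw [hω0] at h1
    simp only [map_sub, Complex.conj_conj] at h1
    have hpη : p * η = -(conj p * conj ζ) := by rw [hη]; field_simp
    have hεη : ε * η = -conj ζ := by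
      apply mul_right_cancel₀ hpc0
      linear_combination η * hεp + hpη
    have h4 : (z - ζ) * ((z - ζ) * (z - η) * deriv f z * ε - p * (f z - w)) = 0 := by
      have h6 : (conj ζ - p + ε * z) * (z * deriv f z * (z - ζ) - ζ * (f z - w)) =
          (1 + (ζ - conj p) * ε * z) * (deriv f z * (z - ζ) - (f z - w)) := by
        linear_combination (1 + (ζ - conj p) * ε * z) * h2 -
          (z * deriv f z * (z - ζ) - ζ * (f z - w)) * h1
      have h7 : (conj ζ - p + ε * z) * z - (1 + (ζ - conj p) * ε * z) =
          ε * (z - ζ) * (z - η) := by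
        linear_combination z * hεp + (z - ζ) * hεη + hζζ
      have h8 : (conj ζ - p + ε * z) * ζ - (1 + (ζ - conj p) * ε * z) = p * (z - ζ) := by
        linear_combination hζζ + z * hεp
      linear_combination h6 - deriv f z * (z - ζ) * h7 + (f z - w) * h8
    have h5 := (mul_eq_zero.1 h4).resolve_left h3
    apply mul_left_cancel₀ hε0
    linear_combination h5 - (f z - w) * hεp
  have hfin := eq_zero_of_bounded_of_deriv_eq (g := fun z => f z - w) (M := M + ‖w‖)
    (hf.differentiableOn.sub_const w)
    (fun z hz => (norm_sub_le _ _).trans (by linarith [hM z hz])) hζ hη1 (sub_ne_zero.1 hζη0)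
    -- Chosen so that `κ (ζ - η) = conj p`.
    (κ := Complex.normSq p / (2 * (p * ζ).re)) (div_pos hpn hre) ?_
  · simp only [hf.map_zero, zero_sub, neg_eq_zero] at hfin
    exact hw0 hfin
  · intro z hz
    have h1 := sub_ne_zero_of_mem_ball hζ hz
    have h2 := sub_ne_zero_of_mem_ball hη1 hz
    have h3 : ((Complex.normSq p / (2 * (p * ζ).re) : ℝ) : ℂ) * (ζ - η) = conj p := by
      have h4 : ((2 * (p * ζ).re : ℝ) : ℂ) ≠ 0 := Complex.ofReal_ne_zero.2 hre.ne'
      rw [hζη, Complex.ofReal_div, ← Complex.mul_conj]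
      field_simp
    rw [deriv_sub_const]
    have h5 : 1 / (z - ζ) - 1 / (z - η) = (ζ - η) / ((z - ζ) * (z - η)) := by
      field_simp; ring
    rw [h5, ← mul_div_assoc, h3, div_mul_eq_mul_div, eq_div_iff (mul_ne_zero h1 h2), ← hode z hz]
    ring

theorem corollary2p2 (f : ℂ → ℂ) (hf : IsNormalizedConvexMapping f)
    (hbdd : Bornology.IsBounded (f '' Metric.ball (0 : ℂ) 1)) :
    ∃ b : ℝ, -(1 / 2 : ℝ) < b ∧
      ∀ z ∈ Metric.ball (0 : ℂ) 1, b ≤ (taylorCoeffAtZero f 2 * f z).re := by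
  obtain ⟨M, hM'⟩ := isBounded_iff_forall_norm_le.1 hbdd
  have hM : ∀ z ∈ ball (0 : ℂ) 1, ‖f z‖ ≤ M := fun z hz => hM' _ (mem_image_of_mem f hz)
  set a := taylorCoeffAtZero f 2 with ha
  have hne : (f '' ball (0 : ℂ) 1).Nonempty := ⟨f 0, mem_image_of_mem f (mem_ball_self one_pos)⟩
  obtain ⟨w, hwK, hwmin⟩ := hbdd.isCompact_closure.exists_isMinOn hne.closure
    (f := fun v => (a * v).re) (by fun_prop)
  have hmin : ∀ z ∈ ball (0 : ℂ) 1, (a * w).re ≤ (a * f z).re := fun z hz =>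
    hwmin (subset_closure (mem_image_of_mem f hz))
  refine ⟨(a * w).re, ?_, hmin⟩
  by_contra! hcon
  have ha0 : a ≠ 0 := by
    rintro h
    rw [h, zero_mul, Complex.zero_re] at hcon
    norm_num at hcon
  -- The image is open, and moving from `w` to `w - t * conj a` lowers `Re (a v)` by `t |a|²`, so
  -- the minimum is not attained inside.
  have hw : ∀ z ∈ ball (0 : ℂ) 1, f z ≠ w := by
    intro z hz hzw
    have hopen := isOpen_image_of_injOn_ball hf.differentiableOn hf.injOn Subset.rfl isOpen_ball
    have hcont : Tendsto (fun t : ℝ => w - t * conj a) (𝓝[>] 0) (𝓝 w) := by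
      have : ContinuousAt (fun t : ℝ => w - t * conj a) 0 := by fun_prop
      simpa using this.tendsto.mono_left (nhdsWithin_le_nhds (s := Ioi (0 : ℝ)))
    have hev := hcont.eventually (hopen.mem_nhds (hzw ▸ mem_image_of_mem f hz))
    obtain ⟨t, ⟨v, hv, hvt⟩, ht⟩ := (hev.and self_mem_nhdsWithin).exists
    have h1 := hmin v hv
    have h2 : a * (w - t * conj a) = a * w - ((t * Complex.normSq a : ℝ) : ℂ) := by
      rw [Complex.ofReal_mul, ← Complex.mul_conj]; ring
    rw [hvt, h2, Complex.sub_re, Complex.ofReal_re] at h1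
    have h3 := mul_pos (mem_Ioi.1 ht) (Complex.normSq_pos.2 ha0)
    linarith
  obtain ⟨y, hy, hyw⟩ := mem_closure_iff_seq_limit.1 hwK
  choose x hxD hxy using hy
  obtain ⟨ζ, hζle, φ, hφ, hlim⟩ := (isCompact_closedBall (0 : ℂ) 1).tendsto_subseq
    (fun n => ball_subset_closedBall (hxD n))
  have hflim : Tendsto (fun n => f (x (φ n))) atTop (𝓝 w) := by
    simp only [hxy]
    exact hyw.comp hφ.tendsto_atTop
  have hζ : ‖ζ‖ = 1 := by
    refine (mem_closedBall_zero_iff.1 hζle).eq_of_not_lt fun hlt => ?_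
    have hζD : ζ ∈ ball (0 : ℂ) 1 := mem_ball_zero_iff.2 hlt
    have h1 := (hf.differentiableOn.differentiableAt (isOpen_ball.mem_nhds hζD)).continuousAt
    exact hw ζ hζD (tendsto_nhds_unique (h1.tendsto.comp hlim) hflim)
  refine hcon.not_gt (hf.neg_half_lt_re_of_boundary hM hζ hw fun z hz => ?_)
  have hz1 := mem_ball_zero_iff.1 hz
  have h1 : Tendsto (fun n => (2 * z * deriv f z / (f z - f (x (φ n))) -
      (z + x (φ n)) / (z - x (φ n))).re) atTop
      (𝓝 (2 * z * deriv f z / (f z - w) - (z + ζ) / (z - ζ)).re) := by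
    refine (Complex.continuous_re.tendsto _).comp (Tendsto.sub ?_ ?_)
    · exact tendsto_const_nhds.div (tendsto_const_nhds.sub hflim) (sub_ne_zero.2 (hw z hz))
    · exact (tendsto_const_nhds.add hlim).div (tendsto_const_nhds.sub hlim)
        (sub_ne_zero_of_mem_ball hζ hz)
  refine ge_of_tendsto h1 ?_
  have h2 : ∀ᶠ n in atTop, ‖z‖ < ‖x (φ n)‖ := hlim.norm.eventually_const_lt (by rw [hζ]; exact hz1)
  filter_upwards [h2] with n hn using hf.re_suffridge_nonneg (hxD _) hn
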